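/- **Theorem 2.2.** Let $1\le k\le n$ and let $a_1,\dots,a_n$ be real random variables. The $k\times n$ *partial symmetric Toeplitz matrix* generated by $a_1,\dots,a_n$ is $$A=\begin{bmatrix} a_n & a_{n-1} & \cdots & a_2 & a_1\\ a_{n-1} & a_n & \cdots & a_3 & a_2\\ \vdots & \vdots & \ddots & & \vdots\\ a_{n-k+1} & a_{n-k+2} & \cdots & \cdots & a_k\end{bmatrix},\qquad A_{ij}=a_{n-|i-j|}\quad(1\le i\le k,\ 1\le j\le n).$$ For $s\in\mathbb N$ and $\delta\in(0,1)$, say that $A$ *satisfies RIP of order $s$ with constant $\delta$* if for every $T\subset\{1,\dots,n\}$ with $|T|\le s$ and every $x\in\mathbb R^{T}$, $$(1-\delta)\|x\|_2^2\le\|A_Tx\|_2^2\le(1+\delta)\|x\|_2^2,$$ where $A_T$ is the $k\times|T|$ submatrix of $A$ formed by the columns with indices in $T$. For every $\delta_{3m}\in(0,1/3)$ there are constants $c_1,c_2>0$ depending only on $\delta_{3m}$ such that the following holds. Let $k,m,n$ be positive integers with $m<n$, $k\le n$ and $$k>c_1\,m^3\,\ln(n/m),$$ and let $a_1,\dots,a_n$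 be independent, all distributed according to the same one of the following three laws: the normal law $\mathcal N(0,1/k)$ (mean $0$, variance $1/k$); the law taking the values $\pm\sqrt{1/k}$ with probability $1/2$ each; the law taking the values $+\sqrt{3/k},\,0,\,-\sqrt{3/k}$ with probabilities $1/6,\,2/3,\,1/6$. Then, with probability at least $$1-e^{-c_2k/m^2},$$ $A$ satisfies RIP of order $3m$ with constant $\delta_{3m}$. -/

import Mathlib

open MeasureTheory ProbabilityTheory
open scoped Matrix NNReal ENNReal

universe u

/-- The `k × n` partial symmetric Toeplitz matrix generated by `a₁, …, aₙ` (stored as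
`a 0, …, a (n - 1)`), where `k ≤ n`: in one-based indices its `(i, j)` entry is `a_{n - |i - j|}`,
so the first row is `aₙ, …, a₂, a₁` and the diagonal is constantly `aₙ`. -/
def partialSymToeplitz {k n : ℕ} (hkn : k ≤ n) (a : Fin n → ℝ) : Matrix (Fin k) (Fin n) ℝ :=
  Matrix.of fun i j => a (Fin.rev ⟨((i : ℤ) - (j : ℤ)).natAbs, by omega⟩)

/-- `A` has the restricted isometry property of order `s` with constant `δ`: for every set `T` of
at most `s` columns, the submatrix `A_T` of these columns satisfies
`(1 - δ) ‖x‖₂² ≤ ‖A_T x‖₂² ≤ (1 + δ) ‖x‖₂²` for all `x`. -/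
def SatisfiesRIP {k n : ℕ} (A : Matrix (Fin k) (Fin n) ℝ) (s : ℕ) (δ : ℝ) : Prop :=
  ∀ T : Finset (Fin n), T.card ≤ s → ∀ x : T → ℝ,
    (1 - δ) * ‖WithLp.toLp 2 x‖ ^ 2 ≤
        ‖WithLp.toLp 2 (A.submatrix id (fun t : T => (t : Fin n)) *ᵥ x)‖ ^ 2 ∧
      ‖WithLp.toLp 2 (A.submatrix id (fun t : T => (t : Fin n)) *ᵥ x)‖ ^ 2 ≤
        (1 + δ) * ‖WithLp.toLp 2 x‖ ^ 2

/-- The normal law `N(0, 1/k)` (the second argument of `gaussianReal` is the variance). -/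
noncomputable def gaussianEntryLaw (k : ℕ) : Measure ℝ :=
  gaussianReal 0 (1 / (k : ℝ≥0))

/-- The law taking the values `√(1/k)` and `-√(1/k)` with probability `1/2` each. -/
noncomputable def bernoulliEntryLaw (k : ℕ) : Measure ℝ :=
  (1 / 2 : ℝ≥0∞) • Measure.dirac (√(1 / (k : ℝ))) +
    (1 / 2 : ℝ≥0∞) • Measure.dirac (-√(1 / (k : ℝ)))

/-- The law taking the values `√(3/k)`, `0`, `-√(3/k)` with probabilities `1/6`, `2/3`, `1/6`. -/
noncomputable def sparseEntryLaw (k : ℕ) : Measure ℝ :=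
  (1 / 6 : ℝ≥0∞) • Measure.dirac (√(3 / (k : ℝ))) +
    (2 / 3 : ℝ≥0∞) • Measure.dirac 0 +
    (1 / 6 : ℝ≥0∞) • Measure.dirac (-√(3 / (k : ℝ)))

/-! The restricted isometry property of order `3m` follows, by Gershgorin's estimate and the
Cauchy–Schwarz inequality, once every entry of the Gram matrix `Aᵀ A` is within `δ / (3m)` of the
corresponding entry of the identity (`satisfiesRIP_of_gram_near_one`). No net and no union over the
column sets `T` is needed: there are only `n²` Gram entries.

A Gram entry is a sum over the `k` rows of products `a_p a_q` of two generators. Its expectation is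
that of the identity up to `1 / k`, the error coming from the single row midway between the two
columns, where both carry the same generator (`abs_sum_integral_sub_one_le`). The products are not
independent, but each row shares a generator with at most five others (`card_conflicting_rows_lt`),
so a greedy colouring splits the rows into `8` classes of independent products. For all three laws
`E exp (k a² / 4) ≤ 3`, hence `a_p a_q` is sub-exponential at scale `1 / k`, and the Chernoff bound
in each class gives a deviation `≥ u` of a Gram entry with probability at most
`16 exp (-k u² / 98304)` (`measureReal_abs_sum_ge_le`).

With `u = δ / (6m)` the union bound over the `n²` entries costs `k / m² ≳ log n`. This is implied by
`k > c₁ m³ log (n / m)`: together with `k ≤ n` the latter forces `n ≥ m²`, so that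
`log (n / m) ≥ log n / 2` (`log_lower_bound_of_lt`). -/

/-! ### From the Gram matrix to the restricted isometry property -/

/-- If every entry of `Aᵀ A` is within `ε` of the identity, then
`|‖A_T x‖² - ‖x‖²| ≤ ε ‖x‖₁² ≤ s ε ‖x‖²` for column sets `T` of size at most `s`. -/
lemma satisfiesRIP_of_gram_near_one {k n : ℕ} (A : Matrix (Fin k) (Fin n) ℝ) (s : ℕ) {δ ε : ℝ}
    (hε : 0 ≤ ε) (hs : s * ε ≤ δ)
    (h : ∀ j j', |∑ i, A i j * A i j' - if j = j' then 1 else 0| ≤ ε) :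
    SatisfiesRIP A s δ := by
  intro T hT x
  have key : |‖WithLp.toLp 2 (A.submatrix id (fun t : T => (t : Fin n)) *ᵥ x)‖ ^ 2
      - ‖WithLp.toLp 2 x‖ ^ 2| ≤ δ * ‖WithLp.toLp 2 x‖ ^ 2 := by
    rw [EuclideanSpace.real_norm_sq_eq, EuclideanSpace.real_norm_sq_eq]
    have hexp : ∑ i, (A.submatrix id (fun t : T => (t : Fin n)) *ᵥ x) i ^ 2 - ∑ t, x t ^ 2
        = ∑ t : T, ∑ t' : T, x t * x t' *
          (∑ i, A i t * A i t' - if (t : Fin n) = t' then 1 else 0) := by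
      have h1 : ∀ i, (A.submatrix id (fun t : T => (t : Fin n)) *ᵥ x) i ^ 2
          = ∑ t : T, ∑ t' : T, x t * x t' * (A i t * A i t') := by
        intro i
        rw [sq, Matrix.mulVec, dotProduct, Finset.sum_mul_sum]
        refine Finset.sum_congr rfl fun t _ => Finset.sum_congr rfl fun t' _ => ?_
        simp only [Matrix.submatrix_apply, id]
        ring
      have h2 : ∑ t : T, x t ^ 2
          = ∑ t : T, ∑ t' : T, x t * x t' * (if (t : Fin n) = t' then 1 else 0) := by
        refine Finset.sum_congr rfl fun t _ => ?_
        rw [Finset.sum_eq_single t]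
        · simp [sq]
        · intro t' _ hne
          rw [if_neg (fun h => hne (Subtype.ext h.symm)), mul_zero]
        · simp
      rw [Finset.sum_congr rfl fun i _ => h1 i, h2, Finset.sum_comm, ← Finset.sum_sub_distrib]
      refine Finset.sum_congr rfl fun t _ => ?_
      rw [Finset.sum_comm, ← Finset.sum_sub_distrib]
      refine Finset.sum_congr rfl fun t' _ => ?_
      rw [← Finset.mul_sum, mul_sub]
    change |∑ i, (A.submatrix id (fun t : T => (t : Fin n)) *ᵥ x) i ^ 2 - ∑ t, x t ^ 2|
      ≤ δ * ∑ t, x t ^ 2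
    rw [hexp]
    have hcs : (∑ t : T, |x t|) ^ 2 ≤ s * ∑ t : T, x t ^ 2 := by
      have := sq_sum_le_card_mul_sum_sq (s := (Finset.univ : Finset T)) (f := fun t => |x t|)
      simp only [sq_abs, Finset.card_univ, Fintype.card_coe] at this
      refine this.trans ?_
      gcongr
    calc _ ≤ ∑ t : T, ∑ t' : T, |x t| * |x t'| * ε := by
          refine (Finset.abs_sum_le_sum_abs _ _).trans (Finset.sum_le_sum fun t _ => ?_)
          refine (Finset.abs_sum_le_sum_abs _ _).trans (Finset.sum_le_sum fun t' _ => ?_)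
          rw [abs_mul, abs_mul]
          gcongr
          exact h _ _
      _ = ε * (∑ t : T, |x t|) ^ 2 := by
          rw [sq, Finset.sum_mul_sum, Finset.mul_sum]
          refine Finset.sum_congr rfl fun t _ => ?_
          rw [Finset.mul_sum]
          exact Finset.sum_congr rfl fun t' _ => by ring
      _ ≤ ε * (s * ∑ t : T, x t ^ 2) := by gcongr
      _ = (s * ε) * ∑ t : T, x t ^ 2 := by ring
      _ ≤ δ * ∑ t : T, x t ^ 2 := by gcongr
  rw [abs_le] at key
  constructor <;> linarith [key.1, key.2]

/-! ### Greedy colouring -/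

/-- A symmetric conflict relation in which every element has fewer than `N` conflicts, those with
itself included, has a proper colouring with `N` colours. -/
lemma exists_coloring_of_card_conflicts_lt {κ : Type*} [Fintype κ] [DecidableEq κ]
    (R : κ → κ → Prop) [DecidableRel R] (hR : ∀ i j, R i j → R j i) (N : ℕ)
    (hN : ∀ i, (Finset.univ.filter (R i)).card < N) :
    ∃ c : κ → Fin N, ∀ i j, i ≠ j → R i j → c i ≠ c j := by
  suffices H : ∀ s : Finset κ, ∃ c : κ → Fin N, ∀ i ∈ s, ∀ j ∈ s, i ≠ j → R i j → c i ≠ c j by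
    obtain ⟨c, hc⟩ := H Finset.univ
    exact ⟨c, fun i j => hc i (Finset.mem_univ _) j (Finset.mem_univ _)⟩
  intro s
  induction s using Finset.induction_on with
  | empty => exact ⟨fun i => ⟨0, (Nat.zero_le _).trans_lt (hN i)⟩, by simp⟩
  | insert a s ha ih =>
    obtain ⟨c, hc⟩ := ih
    obtain ⟨e, -, he⟩ := Finset.exists_mem_notMem_of_card_lt_card
      (s := (Finset.univ.filter (R a)).image c) (t := Finset.univ)
      (by simpa using Finset.card_image_le.trans_lt (hN a))
    have hea : ∀ j, R a j → e ≠ c j := fun j hj hej =>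
      he (Finset.mem_image.2 ⟨j, by simpa using hj, hej.symm⟩)
    refine ⟨Function.update c a e, fun i hi j hj hij hRij => ?_⟩
    rcases eq_or_ne i a with rfl | hia
    · rw [Function.update_self, Function.update_of_ne hij.symm]
      exact hea j hRij
    · rcases eq_or_ne j a with rfl | hja
      · rw [Function.update_self, Function.update_of_ne hij]
        exact (hea i (hR _ _ hRij)).symm
      · rw [Function.update_of_ne hia, Function.update_of_ne hja]
        exact hc i (Finset.mem_of_mem_insert_of_ne hi hia) j
          (Finset.mem_of_mem_insert_of_ne hj hja) hij hRij

/-! ### The entry laws -/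

/-- The properties shared by the three laws: mean `0`, variance `1 / k`, and a sub-Gaussian tail at
scale `1 / √k`, expressed by the bound `E exp (k x² / 4) ≤ 3` (the values are `√2` for the normal
law and at most `exp (3 / 4)` for the other two). -/
structure IsSubgaussianEntryLaw (k : ℕ) (ν : Measure ℝ) : Prop where
  integral_id : ∫ x, x ∂ν = 0
  integral_sq : ∫ x, x ^ 2 ∂ν = 1 / k
  integrable_exp : Integrable (fun x => Real.exp (k * x ^ 2 / 4)) ν
  integral_exp_le : ∫ x, Real.exp (k * x ^ 2 / 4) ∂ν ≤ 3

lemma isSubgaussianEntryLaw_gaussian {k : ℕ} (hk : 0 < k) :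
    IsSubgaussianEntryLaw k (gaussianEntryLaw k) := by
  have hk' : (0 : ℝ) < k := by exact_mod_cast hk
  have hv : (1 / (k : ℝ≥0)) ≠ 0 := by positivity
  have hint : ∫ x, Real.exp (k * x ^ 2 / 4) ∂(gaussianEntryLaw k) = √2 := by
    rw [gaussianEntryLaw, integral_gaussianReal_eq_integral_smul hv]
    have : ∀ x : ℝ, gaussianPDFReal 0 (1 / (k : ℝ≥0)) x • Real.exp (k * x ^ 2 / 4)
        = (√(2 * Real.pi * (1 / k)))⁻¹ * Real.exp (-(k / 4 : ℝ) * x ^ 2) := by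
      intro x
      rw [gaussianPDFReal, smul_eq_mul, mul_assoc, ← Real.exp_add]
      push_cast
      congr 2
      field_simp
      ring
    simp_rw [this]
    rw [integral_const_mul, integral_gaussian, ← Real.sqrt_inv, ← Real.sqrt_mul (by positivity)]
    congr 1
    field_simp
    norm_num
  have h2 : √2 ≤ (3 : ℝ) := Real.sqrt_le_iff.2 ⟨by norm_num, by norm_num⟩
  refine ⟨integral_id_gaussianReal, ?_, ?_, hint.trans_le h2⟩
  · have h := variance_fun_id_gaussianReal (μ := 0) (v := 1 / (k : ℝ≥0))
    rw [variance_of_integral_eq_zero (by fun_prop) integral_id_gaussianReal] at h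
    simpa [gaussianEntryLaw] using h
  · exact Integrable.of_integral_ne_zero (by rw [hint]; positivity)

lemma isSubgaussianEntryLaw_bernoulli {k : ℕ} (hk : 0 < k) :
    IsSubgaussianEntryLaw k (bernoulliEntryLaw k) := by
  have hk' : (0 : ℝ) < k := by exact_mod_cast hk
  have hi : ∀ (f : ℝ → ℝ) (y : ℝ), Integrable f ((1 / 2 : ℝ≥0∞) • Measure.dirac y) := fun f y =>
    (integrable_dirac (by simp)).smul_measure (by norm_num)
  have key : ∀ f : ℝ → ℝ, ∫ x, f x ∂(bernoulliEntryLaw k)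
      = 1 / 2 * f (√(1 / k)) + 1 / 2 * f (-√(1 / k)) := by
    intro f
    rw [bernoulliEntryLaw, integral_add_measure (hi _ _) (hi _ _)]
    simp
  have hs : √(1 / (k : ℝ)) ^ 2 = 1 / k := Real.sq_sqrt (by positivity)
  refine ⟨by rw [key]; ring, by rw [key, neg_sq, hs]; ring, ?_, ?_⟩
  · exact (hi _ _).add_measure (hi _ _)
  · rw [key, neg_sq, hs, mul_one_div_cancel hk'.ne']
    have : Real.exp (1 / 4) ≤ Real.exp 1 := Real.exp_le_exp.2 (by norm_num)
    linarith [Real.exp_one_lt_d9]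

lemma isSubgaussianEntryLaw_sparse {k : ℕ} (hk : 0 < k) :
    IsSubgaussianEntryLaw k (sparseEntryLaw k) := by
  have hk' : (0 : ℝ) < k := by exact_mod_cast hk
  have hi : ∀ (c : ℝ≥0∞) (_ : c ≠ ∞) (f : ℝ → ℝ) (y : ℝ), Integrable f (c • Measure.dirac y) :=
    fun c hc f y => (integrable_dirac (by simp)).smul_measure hc
  have h6 : (1 / 6 : ℝ≥0∞) ≠ ∞ := by norm_num
  have h3 : (2 / 3 : ℝ≥0∞) ≠ ∞ := ENNReal.div_ne_top (by norm_num) (by norm_num)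
  have key : ∀ f : ℝ → ℝ, ∫ x, f x ∂(sparseEntryLaw k)
      = 1 / 6 * f (√(3 / k)) + 2 / 3 * f 0 + 1 / 6 * f (-√(3 / k)) := by
    intro f
    rw [sparseEntryLaw, integral_add_measure ((hi _ h6 _ _).add_measure (hi _ h3 _ _)) (hi _ h6 _ _),
      integral_add_measure (hi _ h6 _ _) (hi _ h3 _ _)]
    simp
  have hs : √(3 / (k : ℝ)) ^ 2 = 3 / k := Real.sq_sqrt (by positivity)
  refine ⟨by rw [key]; ring, by rw [key, neg_sq, hs]; ring, ?_, ?_⟩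
  · exact ((hi _ h6 _ _).add_measure (hi _ h3 _ _)).add_measure (hi _ h6 _ _)
  · rw [key, neg_sq, hs, mul_div_cancel₀ _ hk'.ne']
    have h1 : Real.exp (3 / 4) ≤ Real.exp 1 := Real.exp_le_exp.2 (by norm_num)
    have h2 : Real.exp (k * 0 ^ 2 / 4) = 1 := by simp
    rw [h2]
    linarith [Real.exp_one_lt_d9]

/-! ### Moment generating functions of products of entries -/

lemma exp_le_one_add_add_sq_mul_exp_abs (y : ℝ) :
    Real.exp y ≤ 1 + y + y ^ 2 * Real.exp |y| := by
  rcases le_or_gt |y| 1 with h | h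
  · have h1 := (abs_le.1 (Real.abs_exp_sub_one_sub_id_le h)).2
    have h2 : y ^ 2 * 1 ≤ y ^ 2 * Real.exp |y| := by
      gcongr
      exact Real.one_le_exp (abs_nonneg y)
    linarith
  · have hsq : |y| ≤ y ^ 2 := by rw [← sq_abs]; nlinarith
    rcases le_or_gt 0 y with h0 | h0
    · rw [abs_of_nonneg h0] at *
      have : 1 * Real.exp y ≤ y ^ 2 * Real.exp y := by
        gcongr
        linarith
      linarith
    · have h1 : Real.exp y ≤ 1 := Real.exp_le_one_iff.2 h0.le
      have h2 : y ^ 2 * 1 ≤ y ^ 2 * Real.exp |y| := by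
        gcongr
        exact Real.one_le_exp (abs_nonneg y)
      rw [abs_of_neg h0] at hsq
      linarith

section Mgf

variable {Ω : Type*} [MeasurableSpace Ω] {P : Measure Ω}

/-- A sub-exponential random variable at scale `1 / r` has, after centring, the moment generating
function of a Gaussian of variance of order `1 / r ^ 2` near the origin. -/
lemma mgf_sub_integral_le [IsProbabilityMeasure P] {X : Ω → ℝ} (hX : AEMeasurable X P) {r t : ℝ}
    (hr : 0 < r) (hint : Integrable (fun ω => Real.exp (r * |X ω| / 4)) P)
    (hle : ∫ ω, Real.exp (r * |X ω| / 4) ∂P ≤ 3) (ht : |t| ≤ r / 8) :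
    Integrable (fun ω => Real.exp (t * (X ω - ∫ ω, X ω ∂P))) P ∧
      mgf (fun ω => X ω - ∫ ω, X ω ∂P) P t ≤ Real.exp (384 * t ^ 2 / r ^ 2) := by
  set μ := ∫ ω, X ω ∂P with hμ
  have hXi : Integrable X P := by
    refine (hint.const_mul (4 / r)).mono' hX.aestronglyMeasurable (.of_forall fun ω => ?_)
    have h1 := Real.add_one_le_exp (r * |X ω| / 4)
    rw [Real.norm_eq_abs, div_mul_eq_mul_div, le_div_iff₀ hr]
    linarith
  have hti : Integrable (fun ω => Real.exp (t * X ω)) P := by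
    refine hint.mono' (by fun_prop) (.of_forall fun ω => ?_)
    rw [Real.norm_eq_abs, Real.abs_exp, Real.exp_le_exp]
    calc t * X ω ≤ |t * X ω| := le_abs_self _
      _ = |t| * |X ω| := abs_mul _ _
      _ ≤ r / 8 * |X ω| := by gcongr
      _ ≤ r * |X ω| / 4 := by nlinarith [mul_nonneg hr.le (abs_nonneg (X ω))]
  have heq : ∀ ω, Real.exp (t * (X ω - μ)) = Real.exp (-(t * μ)) * Real.exp (t * X ω) := by
    intro ω
    rw [← Real.exp_add]
    congr 1
    ring
  have hpt : ∀ ω, Real.exp (t * X ω)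
      ≤ 1 + t * X ω + 128 * t ^ 2 / r ^ 2 * Real.exp (r * |X ω| / 4) := by
    intro ω
    refine (exp_le_one_add_add_sq_mul_exp_abs (t * X ω)).trans ?_
    have h1 : Real.exp |t * X ω| ≤ Real.exp (r * |X ω| / 8) := by
      rw [Real.exp_le_exp, abs_mul]
      calc |t| * |X ω| ≤ r / 8 * |X ω| := by gcongr
        _ = r * |X ω| / 8 := by ring
    have h2 : (X ω) ^ 2 ≤ 128 / r ^ 2 * Real.exp (r * |X ω| / 8) := by
      have h0 : 0 ≤ r * |X ω| / 8 := by positivity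
      have := Real.quadratic_le_exp_of_nonneg h0
      rw [div_mul_eq_mul_div, le_div_iff₀ (by positivity), ← sq_abs (X ω)]
      nlinarith
    have h3 : Real.exp (r * |X ω| / 4)
        = Real.exp (r * |X ω| / 8) * Real.exp (r * |X ω| / 8) := by
      rw [← Real.exp_add]
      congr 1
      ring
    have : (t * X ω) ^ 2 * Real.exp |t * X ω|
        ≤ 128 * t ^ 2 / r ^ 2 * Real.exp (r * |X ω| / 4) := by
      rw [h3, mul_pow]
      calc t ^ 2 * X ω ^ 2 * Real.exp |t * X ω|
          ≤ t ^ 2 * (128 / r ^ 2 * Real.exp (r * |X ω| / 8)) * Real.exp (r * |X ω| / 8) := by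
            gcongr
        _ = _ := by ring
    linarith
  have hE : ∫ ω, Real.exp (t * X ω) ∂P ≤ Real.exp (t * μ + 384 * t ^ 2 / r ^ 2) := by
    calc ∫ ω, Real.exp (t * X ω) ∂P
        ≤ ∫ ω, (1 + t * X ω + 128 * t ^ 2 / r ^ 2 * Real.exp (r * |X ω| / 4)) ∂P :=
          integral_mono hti (((integrable_const _).add (hXi.const_mul t)).add
            (hint.const_mul _)) hpt
      _ = 1 + t * μ + 128 * t ^ 2 / r ^ 2 * ∫ ω, Real.exp (r * |X ω| / 4) ∂P := by
          have h1 : Integrable (fun ω => 1 + t * X ω) P :=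
            (integrable_const _).add (hXi.const_mul t)
          rw [integral_add h1 (hint.const_mul _),
            integral_add (integrable_const _) (hXi.const_mul t), integral_const_mul,
            integral_const_mul]
          simp [hμ]
      _ ≤ 1 + t * μ + 128 * t ^ 2 / r ^ 2 * 3 := by gcongr
      _ = (t * μ + 384 * t ^ 2 / r ^ 2) + 1 := by ring
      _ ≤ _ := Real.add_one_le_exp _
  refine ⟨?_, ?_⟩
  · simp_rw [heq]
    exact hti.const_mul _
  · rw [mgf]
    simp_rw [heq]
    rw [integral_const_mul]
    calc _ ≤ Real.exp (-(t * μ)) * Real.exp (t * μ + 384 * t ^ 2 / r ^ 2) := by gcongr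
      _ = _ := by rw [← Real.exp_add]; congr 1; ring

variable {ι κ : Type*} {a : ι → Ω → ℝ} {k : ℕ} {ν : Measure ℝ}

/-- Exponential integrability passes from the entries to their products by `|xy| ≤ (x² + y²) / 2`
and the arithmetic-geometric mean inequality; no independence is involved, so `p = q` is allowed. -/
lemma integrable_exp_abs_mul (hk : 0 < k) (hν : IsSubgaussianEntryLaw k ν)
    (hlaw : ∀ i, HasLaw (a i) ν P) (p q : ι) :
    Integrable (fun ω => Real.exp (k * |a p ω * a q ω| / 4)) P ∧
      ∫ ω, Real.exp (k * |a p ω * a q ω| / 4) ∂P ≤ 3 := by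
  have hk' : (0 : ℝ) < k := by exact_mod_cast hk
  have hm : Measurable fun x : ℝ => Real.exp (k * x ^ 2 / 4) := by fun_prop
  have hI : ∀ i, Integrable (fun ω => Real.exp (k * a i ω ^ 2 / 4)) P := fun i => by
    have h := hν.integrable_exp
    rw [← (hlaw i).map_eq] at h
    exact h.comp_aemeasurable (hlaw i).aemeasurable
  have hE : ∀ i, ∫ ω, Real.exp (k * a i ω ^ 2 / 4) ∂P ≤ 3 := fun i => by
    have := (hlaw i).integral_comp (f := fun x : ℝ => Real.exp (k * x ^ 2 / 4))
      hm.aestronglyMeasurable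
    exact (this.trans_le hν.integral_exp_le)
  have hpt : ∀ ω, Real.exp (k * |a p ω * a q ω| / 4)
      ≤ 1 / 2 * Real.exp (k * a p ω ^ 2 / 4) + 1 / 2 * Real.exp (k * a q ω ^ 2 / 4) := by
    intro ω
    have h1 : k * |a p ω * a q ω| / 4
        ≤ k * a p ω ^ 2 / 4 / 2 + k * a q ω ^ 2 / 4 / 2 := by
      have : |a p ω * a q ω| ≤ (a p ω ^ 2 + a q ω ^ 2) / 2 := by
        rw [abs_mul, ← sq_abs (a p ω), ← sq_abs (a q ω)]
        nlinarith [sq_nonneg (|a p ω| - |a q ω|)]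
      nlinarith
    refine (Real.exp_le_exp.2 h1).trans ?_
    have h2 : ∀ x : ℝ, Real.exp x = Real.exp (x / 2) ^ 2 := fun x => by
      rw [← Real.exp_nat_mul]; congr 1; push_cast; ring
    rw [Real.exp_add, h2 (k * a p ω ^ 2 / 4), h2 (k * a q ω ^ 2 / 4)]
    nlinarith [sq_nonneg (Real.exp (k * a p ω ^ 2 / 4 / 2) - Real.exp (k * a q ω ^ 2 / 4 / 2))]
  have hp := (hlaw p).aemeasurable
  have hq := (hlaw q).aemeasurable
  have hsum := ((hI p).const_mul (1 / 2)).add ((hI q).const_mul (1 / 2))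
  have hint : Integrable (fun ω => Real.exp (k * |a p ω * a q ω| / 4)) P := by
    refine hsum.mono' ?_ (.of_forall fun ω => ?_)
    · exact ((((hp.mul hq).norm).const_mul (k : ℝ)).div_const 4).exp.aestronglyMeasurable
    · rw [Real.norm_eq_abs, Real.abs_exp]
      exact hpt ω
  refine ⟨hint, (integral_mono hint hsum hpt).trans ?_⟩
  simp only [Pi.add_apply]
  rw [integral_add ((hI p).const_mul _) ((hI q).const_mul _), integral_const_mul,
    integral_const_mul]
  linarith [hE p, hE q]

lemma integral_mul_entry (hν : IsSubgaussianEntryLaw k ν)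
    (hlaw : ∀ i, HasLaw (a i) ν P) (hind : iIndepFun a P) [DecidableEq ι] (p q : ι) :
    ∫ ω, a p ω * a q ω ∂P = if p = q then 1 / (k : ℝ) else 0 := by
  split_ifs with h
  · subst h
    have := (hlaw p).integral_comp (f := fun x : ℝ => x ^ 2) (by fun_prop)
    rw [hν.integral_sq] at this
    rw [← this]
    exact integral_congr_ae (.of_forall fun ω => by simp [sq])
  · rw [(hind.indepFun h).integral_fun_mul_eq_mul_integral
      (hlaw p).aemeasurable.aestronglyMeasurable (hlaw q).aemeasurable.aestronglyMeasurable,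
      (hlaw p).integral_eq, hν.integral_id, zero_mul]

/-- Products of entries with pairwise disjoint index pairs are independent, so the bound on their
moment generating functions multiplies. -/
lemma mgf_sum_mul_sub_le [IsProbabilityMeasure P] [DecidableEq ι] (hind : iIndepFun a P)
    (hmeas : ∀ i, AEMeasurable (a i) P) (p q : κ → ι) (b : κ → ℝ) {t v : ℝ} (s : Finset κ)
    (hdisj : ∀ i ∈ s, ∀ j ∈ s, i ≠ j → Disjoint ({p i, q i} : Finset ι) {p j, q j})
    (hint : ∀ i ∈ s, Integrable (fun ω => Real.exp (t * (a (p i) ω * a (q i) ω - b i))) P)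
    (hmgf : ∀ i ∈ s, mgf (fun ω => a (p i) ω * a (q i) ω - b i) P t ≤ Real.exp v) :
    Integrable (fun ω => Real.exp (t * ∑ i ∈ s, (a (p i) ω * a (q i) ω - b i))) P ∧
      mgf (fun ω => ∑ i ∈ s, (a (p i) ω * a (q i) ω - b i)) P t ≤ Real.exp (s.card * v) := by
  classical
  induction s using Finset.induction_on with
  | empty => simp [mgf]
  | insert i s hi ih =>
    obtain ⟨ih1, ih2⟩ := ih
      (fun x hx y hy => hdisj x (Finset.mem_insert_of_mem hx) y (Finset.mem_insert_of_mem hy))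
      (fun x hx => hint x (Finset.mem_insert_of_mem hx))
      (fun x hx => hmgf x (Finset.mem_insert_of_mem hx))
    set S : Finset ι := {p i, q i} with hS
    set T : Finset ι := s.biUnion fun j => {p j, q j} with hT
    have hST : Disjoint S T := by
      rw [hT, Finset.disjoint_biUnion_right]
      intro j hj
      exact hdisj i (Finset.mem_insert_self _ _) j (Finset.mem_insert_of_mem hj)
        (fun h => hi (h ▸ hj))
    have hpS : p i ∈ S := by simp [hS]
    have hqS : q i ∈ S := by simp [hS]
    have hpT : ∀ j : s, p j ∈ T := fun j => Finset.mem_biUnion.2 ⟨j, j.2, by simp⟩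
    have hqT : ∀ j : s, q j ∈ T := fun j => Finset.mem_biUnion.2 ⟨j, j.2, by simp⟩
    have hI : IndepFun (fun ω => a (p i) ω * a (q i) ω - b i)
        (fun ω => ∑ j ∈ s, (a (p j) ω * a (q j) ω - b j)) P := by
      have h0 := hind.indepFun_finset₀ S T hST hmeas
      have h1 := h0.comp (φ := fun y : S → ℝ => y ⟨p i, hpS⟩ * y ⟨q i, hqS⟩ - b i)
        (ψ := fun y : T → ℝ => ∑ j : s, (y ⟨p j, hpT j⟩ * y ⟨q j, hqT j⟩ - b j))
        (by fun_prop) (by fun_prop)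
      have h2 : (fun ω => ∑ j ∈ s, (a (p j) ω * a (q j) ω - b j))
          = fun ω => ∑ j : s, (a (p j) ω * a (q j) ω - b j) := by
        funext ω
        exact (Finset.sum_coe_sort s fun j => (a (p j) ω * a (q j) ω - b j)).symm
      rw [h2]
      exact h1
    simp_rw [Finset.sum_insert hi]
    have hi1 := hint i (Finset.mem_insert_self _ _)
    refine ⟨hI.integrable_exp_mul_add hi1 ih1, ?_⟩
    have hadd := hI.mgf_add hi1.aestronglyMeasurable ih1.aestronglyMeasurable
    refine (le_of_eq hadd).trans ?_
    rw [Finset.card_insert_of_notMem hi]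
    push_cast
    rw [add_mul, one_mul, add_comm, Real.exp_add]
    exact mul_le_mul (hmgf i (Finset.mem_insert_self _ _)) ih2 mgf_nonneg (Real.exp_pos _).le

/-! ### Concentration of sums of products of entries -/

/-- A Chernoff bound for one colour class. -/
lemma measureReal_abs_sum_disjoint_ge_le [IsProbabilityMeasure P] [DecidableEq ι] (hk : 0 < k)
    (hν : IsSubgaussianEntryLaw k ν) (hlaw : ∀ i, HasLaw (a i) ν P) (hind : iIndepFun a P)
    (p q : κ → ι) (s : Finset κ) (hs : s.card ≤ k)
    (hdisj : ∀ i ∈ s, ∀ j ∈ s, i ≠ j → Disjoint ({p i, q i} : Finset ι) {p j, q j})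
    {u : ℝ} (hu : 0 ≤ u) (hu' : u ≤ 96) :
    P.real {ω | u ≤ |∑ i ∈ s, (a (p i) ω * a (q i) ω - ∫ ω, a (p i) ω * a (q i) ω ∂P)|}
      ≤ 2 * Real.exp (-(k * u ^ 2 / 1536)) := by
  have hk' : (0 : ℝ) < k := by exact_mod_cast hk
  have hs' : (s.card : ℝ) ≤ k := by exact_mod_cast hs
  set S : Ω → ℝ := fun ω =>
    ∑ i ∈ s, (a (p i) ω * a (q i) ω - ∫ ω, a (p i) ω * a (q i) ω ∂P) with hSdef
  have key : ∀ t : ℝ, |t| ≤ k / 8 → Integrable (fun ω => Real.exp (t * S ω)) P ∧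
      mgf S P t ≤ Real.exp (384 * t ^ 2 / k) := by
    intro t ht
    have h1 := fun i : κ => mgf_sub_integral_le (P := P) (t := t)
      (X := fun ω => a (p i) ω * a (q i) ω)
      ((hlaw (p i)).aemeasurable.mul (hlaw (q i)).aemeasurable) hk'
      (integrable_exp_abs_mul hk hν hlaw (p i) (q i)).1
      (integrable_exp_abs_mul hk hν hlaw (p i) (q i)).2 ht
    obtain ⟨h2, h3⟩ := mgf_sum_mul_sub_le hind (fun i => (hlaw i).aemeasurable) p q
      (fun i => ∫ ω, a (p i) ω * a (q i) ω ∂P) s hdisj (fun i _ => (h1 i).1) (fun i _ => (h1 i).2)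
    refine ⟨h2, h3.trans (Real.exp_le_exp.2 ?_)⟩
    calc s.card * (384 * t ^ 2 / (k : ℝ) ^ 2) ≤ k * (384 * t ^ 2 / (k : ℝ) ^ 2) := by gcongr
      _ = 384 * t ^ 2 / k := by field_simp
  -- the minimiser of `-t u + 384 t² / k`
  set t : ℝ := k * u / 768 with ht
  have ht0 : 0 ≤ t := by positivity
  have htk : t ≤ k / 8 := by rw [ht]; nlinarith
  have hexp : -t * u + 384 * t ^ 2 / k = -(k * u ^ 2 / 1536) := by
    rw [ht]; field_simp; ring
  obtain ⟨hi1, hm1⟩ := key t (by rwa [abs_of_nonneg ht0])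
  obtain ⟨hi2, hm2⟩ := key (-t) (by rwa [abs_neg, abs_of_nonneg ht0])
  have hup : P.real {ω | u ≤ S ω} ≤ Real.exp (-(k * u ^ 2 / 1536)) := by
    refine (measure_ge_le_exp_mul_mgf u ht0 hi1).trans ?_
    rw [← hexp, Real.exp_add]
    gcongr
  have hlow : P.real {ω | S ω ≤ -u} ≤ Real.exp (-(k * u ^ 2 / 1536)) := by
    refine (measure_le_le_exp_mul_mgf (-u) (by linarith) hi2).trans ?_
    rw [← hexp, Real.exp_add, neg_neg, mul_neg, neg_mul]
    rw [neg_sq] at hm2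
    gcongr
  have hsub : {ω | u ≤ |S ω|} ⊆ {ω | u ≤ S ω} ∪ {ω | S ω ≤ -u} := by
    intro ω hω
    rcases le_abs.1 (show u ≤ |S ω| from hω) with h | h
    · exact Or.inl h
    · exact Or.inr (by change S ω ≤ -u; linarith)
  calc P.real {ω | u ≤ |S ω|} ≤ P.real ({ω | u ≤ S ω} ∪ {ω | S ω ≤ -u}) :=
        measureReal_mono hsub
    _ ≤ _ := measureReal_union_le _ _
    _ ≤ _ := by linarith

/-- If every term shares an index with fewer than `8` terms (itself included), the terms split into
`8` classes of independent ones, and the deviation of one of the classes is at least an eighth of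
the total deviation. -/
lemma measureReal_abs_sum_ge_le [IsProbabilityMeasure P] [DecidableEq ι] [Fintype κ] [DecidableEq κ]
    (hk : 0 < k) (hν : IsSubgaussianEntryLaw k ν) (hlaw : ∀ i, HasLaw (a i) ν P)
    (hind : iIndepFun a P) (p q : κ → ι) (hcard : Fintype.card κ ≤ k)
    (hconf : ∀ i, (Finset.univ.filter fun j =>
      ¬ Disjoint ({p i, q i} : Finset ι) {p j, q j}).card < 8)
    {u : ℝ} (hu : 0 ≤ u) (hu' : u ≤ 768) :
    P.real {ω | u ≤ |∑ i, (a (p i) ω * a (q i) ω - ∫ ω, a (p i) ω * a (q i) ω ∂P)|}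
      ≤ 16 * Real.exp (-(k * u ^ 2 / 98304)) := by
  obtain ⟨c, hc⟩ := exists_coloring_of_card_conflicts_lt
    (fun i j => ¬ Disjoint ({p i, q i} : Finset ι) {p j, q j})
    (fun i j h h' => h h'.symm) 8 hconf
  set W : κ → Ω → ℝ := fun i ω => a (p i) ω * a (q i) ω - ∫ ω, a (p i) ω * a (q i) ω ∂P with hW
  have hclass : ∀ e : Fin 8, P.real {ω | u / 8 ≤ |∑ i ∈ Finset.univ.filter (c · = e), W i ω|}
      ≤ 2 * Real.exp (-(k * u ^ 2 / 98304)) := by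
    intro e
    refine (measureReal_abs_sum_disjoint_ge_le hk hν hlaw hind p q
      (Finset.univ.filter (c · = e)) ((Finset.card_le_univ _).trans hcard) ?_
      (u := u / 8) (by positivity) (by linarith)).trans (le_of_eq ?_)
    · intro i hi j hj hij
      by_contra h
      refine hc i j hij h ?_
      rw [(Finset.mem_filter.1 hi).2, (Finset.mem_filter.1 hj).2]
    · congr 2
      ring
  have hsub : {ω | u ≤ |∑ i, W i ω|}
      ⊆ ⋃ e : Fin 8, {ω | u / 8 ≤ |∑ i ∈ Finset.univ.filter (c · = e), W i ω|} := by
    intro ω hω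
    by_contra hcon
    simp only [Set.mem_iUnion, not_exists] at hcon
    have h1 : ∀ e : Fin 8, |∑ i ∈ Finset.univ.filter (c · = e), W i ω| < u / 8 :=
      fun e => not_le.1 (hcon e)
    have h2 : ∑ i, W i ω = ∑ e : Fin 8, ∑ i ∈ Finset.univ.filter (c · = e), W i ω :=
      (Finset.sum_fiberwise _ _ _).symm
    have h3 : |∑ i, W i ω| < u := by
      rw [h2]
      calc _ ≤ ∑ e : Fin 8, |∑ i ∈ Finset.univ.filter (c · = e), W i ω| :=
            Finset.abs_sum_le_sum_abs _ _
        _ < ∑ _e : Fin 8, u / 8 := Finset.sum_lt_sum_of_nonempty Finset.univ_nonempty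
            fun e _ => h1 e
        _ = u := by simp; ring
    exact absurd (show u ≤ |∑ i, W i ω| from hω) (not_le.2 h3)
  calc _ ≤ P.real (⋃ e : Fin 8, {ω | u / 8 ≤ |∑ i ∈ Finset.univ.filter (c · = e), W i ω|}) :=
        measureReal_mono hsub
    _ ≤ ∑ e : Fin 8, P.real {ω | u / 8 ≤ |∑ i ∈ Finset.univ.filter (c · = e), W i ω|} :=
        measureReal_iUnion_fintype_le _
    _ ≤ ∑ _e : Fin 8, 2 * Real.exp (-(k * u ^ 2 / 98304)) := Finset.sum_le_sum fun e _ => hclass e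
    _ = _ := by simp; ring

end Mgf

/-! ### Numerical constraints on `k`, `m`, `n` -/

/-- The hypothesis on `k` makes `n` at least `m ^ 2`, so that `log (n / m)` may be replaced by
`log n / 2`. -/
lemma log_lower_bound_of_lt {k n m : ℕ} (hkn : k ≤ n) (hm : 1 ≤ m) (hmn : m < n) {c : ℝ}
    (hc : 4 ≤ c) (h : c * (m : ℝ) ^ 3 * Real.log ((n : ℝ) / m) < k) :
    c * (m : ℝ) ^ 3 * (Real.log n / 2) < k := by
  have hm' : (1 : ℝ) ≤ m := by exact_mod_cast hm
  have hmn' : (m : ℝ) + 1 ≤ n := by exact_mod_cast hmn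
  have hkn' : (k : ℝ) ≤ n := by exact_mod_cast hkn
  have hn : (0 : ℝ) < n := by linarith
  have hm0 : (0 : ℝ) < m := by linarith
  have hlog : 1 - (m : ℝ) / n ≤ Real.log ((n : ℝ) / m) := by
    have := Real.one_sub_inv_le_log_of_pos (x := (n : ℝ) / m) (by positivity)
    rwa [inv_div] at this
  have hlog' : ((n : ℝ) - m) ≤ n * Real.log ((n : ℝ) / m) := by
    have h1 := mul_le_mul_of_nonneg_left hlog hn.le
    rwa [mul_sub, mul_one, mul_div_cancel₀ _ hn.ne'] at h1
  have hL : 0 ≤ Real.log ((n : ℝ) / m) := Real.log_nonneg (by rw [le_div_iff₀ hm0]; linarith)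
  have hmain : 4 * (m : ℝ) ^ 3 * (n - m) < n ^ 2 := by
    calc 4 * (m : ℝ) ^ 3 * (n - m) ≤ c * m ^ 3 * (n * Real.log ((n : ℝ) / m)) := by
          have : 0 ≤ (n : ℝ) - m := by linarith
          gcongr
      _ = n * (c * m ^ 3 * Real.log ((n : ℝ) / m)) := by ring
      _ < n * n := by gcongr; linarith
      _ = n ^ 2 := by ring
  have hsq : (m : ℝ) ^ 2 ≤ n := by
    rcases le_or_gt (2 * (m : ℝ)) n with h2 | h2
    · have h3 : 2 * (m : ℝ) ^ 3 < n := by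
        have : 2 * (m : ℝ) ^ 3 * n ≤ 4 * (m : ℝ) ^ 3 * (n - m) := by
          have : 0 ≤ 2 * (m : ℝ) ^ 3 * (n - 2 * m) := by
            apply mul_nonneg <;> [positivity; linarith]
          nlinarith
        have h4 : 2 * (m : ℝ) ^ 3 * n < n * n := by nlinarith
        exact lt_of_mul_lt_mul_right h4 hn.le
      have : (m : ℝ) ^ 2 ≤ m ^ 3 := pow_le_pow_right₀ hm' (by norm_num)
      nlinarith [pow_pos hm0 3]
    · exfalso
      have h3 : (n : ℝ) ^ 2 ≤ (2 * m) ^ 2 := by gcongr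
      have h4 : (m : ℝ) ^ 2 ≤ m ^ 3 := pow_le_pow_right₀ hm' (by norm_num)
      have h5 : 4 * (m : ℝ) ^ 3 * 1 ≤ 4 * (m : ℝ) ^ 3 * (n - m) := by
        gcongr; linarith
      nlinarith
  have hlog2 : Real.log n / 2 ≤ Real.log ((n : ℝ) / m) := by
    rw [Real.log_div hn.ne' hm0.ne']
    have := Real.log_le_log (by positivity) hsq
    rw [Real.log_pow] at this
    push_cast at this
    linarith
  calc c * (m : ℝ) ^ 3 * (Real.log n / 2)
      ≤ c * (m : ℝ) ^ 3 * Real.log ((n : ℝ) / (m : ℝ)) := by gcongr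
    _ < (k : ℝ) := h

lemma sixteen_mul_sq_mul_exp_le {n : ℕ} (hn : 2 ≤ n) {x : ℝ} (hx : 6 * Real.log n ≤ x) :
    16 * (n : ℝ) ^ 2 * Real.exp (-(2 * x)) ≤ Real.exp (-x) := by
  have hn' : (2 : ℝ) ≤ n := by exact_mod_cast hn
  have h1 : 16 * (n : ℝ) ^ 2 ≤ Real.exp x := by
    calc 16 * (n : ℝ) ^ 2 = 2 ^ 4 * (n : ℝ) ^ 2 := by norm_num
      _ ≤ (n : ℝ) ^ 4 * (n : ℝ) ^ 2 := by gcongr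
      _ = (n : ℝ) ^ 6 := by ring
      _ = Real.exp (6 * Real.log n) := by
          rw [← Real.rpow_natCast, Real.rpow_def_of_pos (by linarith)]
          congr 1
          push_cast
          ring
      _ ≤ Real.exp x := Real.exp_le_exp.2 hx
  calc 16 * (n : ℝ) ^ 2 * Real.exp (-(2 * x)) ≤ Real.exp x * Real.exp (-(2 * x)) := by gcongr
    _ = Real.exp (-x) := by rw [← Real.exp_add]; congr 1; ring

/-! ### The Gram matrix of the partial symmetric Toeplitz matrix -/

/-- The zero-based index of the generator standing at position `(i, j)` of `partialSymToeplitz`. -/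
def toeplitzIndex {k n : ℕ} (hkn : k ≤ n) (j : Fin n) (i : Fin k) : Fin n :=
  Fin.rev ⟨((i : ℤ) - (j : ℤ)).natAbs, by omega⟩

lemma toeplitzIndex_eq_iff {k n : ℕ} (hkn : k ≤ n) (j j' : Fin n) (i i' : Fin k) :
    toeplitzIndex hkn j i = toeplitzIndex hkn j' i' ↔
      (i : ℤ) - j = i' - j' ∨ (i : ℤ) - j = -(i' - j') := by
  rw [toeplitzIndex, toeplitzIndex, Fin.rev_inj, Fin.mk.injEq, Int.natAbs_eq_natAbs_iff]

/-- For fixed columns `j`, `j'`, row `i` shares a generator, apart from itself, only with the rows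
`2j - i`, `2j' - i`, `j + j' - i` and `i ± (j - j')`. -/
lemma card_conflicting_rows_lt {k n : ℕ} (hkn : k ≤ n) (j j' : Fin n) (i : Fin k) :
    (Finset.univ.filter fun i' => ¬ Disjoint
      ({toeplitzIndex hkn j i, toeplitzIndex hkn j' i} : Finset (Fin n))
      {toeplitzIndex hkn j i', toeplitzIndex hkn j' i'}).card < 8 := by
  have hsub : (Finset.univ.filter fun i' => ¬ Disjoint
      ({toeplitzIndex hkn j i, toeplitzIndex hkn j' i} : Finset (Fin n))
      {toeplitzIndex hkn j i', toeplitzIndex hkn j' i'}).image (fun i' : Fin k => (i' : ℤ)) ⊆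
      ([(i : ℤ), 2 * j - i, 2 * j' - i, j + j' - i, i + (j - j'), i - (j - j')]).toFinset := by
    intro z hz
    obtain ⟨i', hi', rfl⟩ := Finset.mem_image.1 hz
    have h := (Finset.mem_filter.1 hi').2
    simp only [Finset.disjoint_insert_left, Finset.disjoint_singleton_left, Finset.mem_insert,
      Finset.mem_singleton, not_and_or, not_not, toeplitzIndex_eq_iff] at h
    simp only [List.mem_toFinset, List.mem_cons, List.not_mem_nil, or_false]
    omega
  rw [← Finset.card_image_of_injective _
    (fun x y h => Fin.ext (Int.natCast_inj.1 h) :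
      Function.Injective fun i' : Fin k => (i' : ℤ))]
  exact ((Finset.card_le_card hsub).trans (List.toFinset_card_le _)).trans_lt (by simp)

/-- The expected Gram matrix differs from the identity by at most `1 / k` in each entry: two
distinct columns carry the same generator in at most one row, midway between their indices. -/
lemma abs_sum_integral_sub_one_le {k n : ℕ} (hkn : k ≤ n) (hk : 0 < k) (j j' : Fin n) :
    |(∑ i : Fin k, if toeplitzIndex hkn j i = toeplitzIndex hkn j' i then 1 / (k : ℝ) else 0)
      - if j = j' then 1 else 0| ≤ 1 / k := by
  have hk' : (0 : ℝ) < k := by exact_mod_cast hk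
  by_cases h : j = j'
  · subst h
    simp [hk'.ne']
  · rw [if_neg h, sub_zero, ← Finset.sum_filter, Finset.sum_const, nsmul_eq_mul,
      abs_of_nonneg (by positivity)]
    have hcard : (Finset.univ.filter fun i : Fin k =>
        toeplitzIndex hkn j i = toeplitzIndex hkn j' i).card ≤ 1 := by
      rw [Finset.card_le_one]
      intro x hx y hy
      simp only [Finset.mem_filter, toeplitzIndex_eq_iff] at hx hy
      have hne : (j : ℤ) ≠ j' := fun h' => h (Fin.ext (by exact_mod_cast h'))
      apply Fin.ext
      omega
    have : (((Finset.univ.filter fun i : Fin k =>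
        toeplitzIndex hkn j i = toeplitzIndex hkn j' i).card : ℕ) : ℝ) ≤ 1 := by
      exact_mod_cast hcard
    calc _ ≤ 1 * (1 / (k : ℝ)) := by gcongr
      _ = _ := one_mul _

/-- Failure of the restricted isometry property forces a large deviation of some Gram entry. -/
lemma one_sub_le_measureReal_satisfiesRIP {Ω : Type*} [MeasurableSpace Ω] {P : Measure Ω}
    [IsProbabilityMeasure P] {k n s : ℕ} (hkn : k ≤ n) (hk : 0 < k) {ν : Measure ℝ}
    (hν : IsSubgaussianEntryLaw k ν) {a : Fin n → Ω → ℝ} (hlaw : ∀ i, HasLaw (a i) ν P)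
    (hind : iIndepFun a P) {δ u : ℝ} (hu : 0 ≤ u) (hu' : u ≤ 768) (hku : 1 / (k : ℝ) ≤ u)
    (hs : s * (2 * u) ≤ δ) :
    1 - 16 * (n : ℝ) ^ 2 * Real.exp (-(k * u ^ 2 / 98304)) ≤
      P.real {ω | SatisfiesRIP (partialSymToeplitz hkn (fun i => a i ω)) s δ} := by
  set p : Fin n → Fin k → Fin n := toeplitzIndex hkn with hp
  set W : Fin n → Fin n → Ω → ℝ := fun j j' ω => ∑ i : Fin k,
    (a (p j i) ω * a (p j' i) ω - ∫ ω, a (p j i) ω * a (p j' i) ω ∂P) with hW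
  set G := {ω | SatisfiesRIP (partialSymToeplitz hkn (fun i => a i ω)) s δ} with hG
  have hsub : Gᶜ ⊆ ⋃ j : Fin n, ⋃ j' : Fin n, {ω | u ≤ |W j j' ω|} := by
    intro ω hω
    by_contra hcon
    simp only [Set.mem_iUnion, not_exists] at hcon
    refine hω (satisfiesRIP_of_gram_near_one _ s (ε := 2 * u) (by positivity) hs fun j j' => ?_)
    have h1 : |W j j' ω| < u := not_le.1 (hcon j j')
    have h2 := abs_sum_integral_sub_one_le hkn hk j j'
    have h3 : ∑ i, partialSymToeplitz hkn (fun i => a i ω) i j *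
        partialSymToeplitz hkn (fun i => a i ω) i j' - (if j = j' then 1 else 0)
        = W j j' ω + ((∑ i : Fin k,
          if toeplitzIndex hkn j i = toeplitzIndex hkn j' i then 1 / (k : ℝ) else 0)
          - if j = j' then 1 else 0) := by
      simp only [hW, Finset.sum_sub_distrib, integral_mul_entry hν hlaw hind]
      rw [sub_add_sub_cancel]
      rfl
    rw [h3]
    exact (abs_add_le _ _).trans (by linarith)
  have hbad : P.real Gᶜ ≤ 16 * (n : ℝ) ^ 2 * Real.exp (-(k * u ^ 2 / 98304)) := by
    calc P.real Gᶜ ≤ P.real (⋃ j : Fin n, ⋃ j' : Fin n, {ω | u ≤ |W j j' ω|}) :=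
          measureReal_mono hsub
      _ ≤ ∑ j : Fin n, P.real (⋃ j' : Fin n, {ω | u ≤ |W j j' ω|}) :=
          measureReal_iUnion_fintype_le _
      _ ≤ ∑ j : Fin n, ∑ j' : Fin n, P.real {ω | u ≤ |W j j' ω|} :=
          Finset.sum_le_sum fun j _ => measureReal_iUnion_fintype_le _
      _ ≤ ∑ _j : Fin n, ∑ _j' : Fin n, 16 * Real.exp (-(k * u ^ 2 / 98304)) :=
          Finset.sum_le_sum fun j _ => Finset.sum_le_sum fun j' _ =>
            measureReal_abs_sum_ge_le hk hν hlaw hind (p j) (p j') (by simp)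
              (card_conflicting_rows_lt hkn j j') hu hu'
      _ = _ := by simp; ring
  -- subadditivity, which needs no measurability of `G`
  have hone : 1 ≤ P.real G + P.real Gᶜ := by
    have h := measureReal_union_le (μ := P) G Gᶜ
    rwa [Set.union_compl_self, probReal_univ] at h
  linarith

/-! ### The choice of the constants -/

theorem theorem2p2 (δ : ℝ) (hδ : δ ∈ Set.Ioo (0 : ℝ) (1 / 3)) :
    ∃ c₁ c₂ : ℝ, 0 < c₁ ∧ 0 < c₂ ∧
      ∀ (k n m : ℕ) (hkn : k ≤ n), 1 ≤ m → m < n →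
        (k : ℝ) > c₁ * (m : ℝ) ^ 3 * Real.log ((n : ℝ) / (m : ℝ)) →
        ∀ ν : Measure ℝ,
          (ν = gaussianEntryLaw k ∨ ν = bernoulliEntryLaw k ∨ ν = sparseEntryLaw k) →
          ∀ (Ω : Type u) [MeasurableSpace Ω] (P : Measure Ω) [IsProbabilityMeasure P]
            (a : Fin n → Ω → ℝ),
            (∀ i, HasLaw (a i) ν P) → iIndepFun a P →
            P.real {ω | SatisfiesRIP (partialSymToeplitz hkn (fun i => a i ω)) (3 * m) δ} ≥
              1 - Real.exp (-(c₂ * (k : ℝ) / (m : ℝ) ^ 2)) := by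
  obtain ⟨hδ0, hδ1⟩ := hδ
  -- `2 c₂ k / m²` is the exponent `k u² / 98304` for the deviation `u = δ / (6 m)`
  set c₂ : ℝ := δ ^ 2 / 7077888 with hc₂
  have hc₂0 : 0 < c₂ := by positivity
  have hc₁ : 24 / δ ≤ 12 / c₂ := by
    rw [div_le_div_iff₀ hδ0 hc₂0, hc₂]
    nlinarith
  have hc₁' : 72 ≤ 24 / δ := by
    rw [le_div_iff₀ hδ0]
    linarith
  refine ⟨12 / c₂, c₂, by positivity, hc₂0, ?_⟩
  intro k n m hkn hm hmn hk ν hν Ω _ P _ a hlaw hind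
  have hm' : (1 : ℝ) ≤ m := by exact_mod_cast hm
  have hn2 : 2 ≤ n := by omega
  have hn2' : (2 : ℝ) ≤ n := by exact_mod_cast hn2
  have hbig := log_lower_bound_of_lt hkn hm hmn (by linarith) hk
  have hlog : 1 / 2 ≤ Real.log n := by
    have := Real.log_le_log (by norm_num) hn2'
    linarith [Real.log_two_gt_d9]
  have hk0' : (0 : ℝ) < k := lt_of_le_of_lt (by positivity) hbig
  have hk0 : 0 < k := by exact_mod_cast hk0'
  have hsub : IsSubgaussianEntryLaw k ν := by
    rcases hν with rfl | rfl | rfl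
    · exact isSubgaussianEntryLaw_gaussian hk0
    · exact isSubgaussianEntryLaw_bernoulli hk0
    · exact isSubgaussianEntryLaw_sparse hk0
  have hku : 1 / (k : ℝ) ≤ δ / (6 * m) := by
    rw [div_le_div_iff₀ hk0' (by positivity), one_mul]
    have h1 : 24 / δ * (m : ℝ) * (1 / 2 / 2) ≤ 12 / c₂ * (m : ℝ) ^ 3 * (Real.log n / 2) := by
      gcongr
      exact le_self_pow₀ hm' (by norm_num)
    have h2 : 24 / δ * (m : ℝ) * (1 / 2 / 2) = 6 * m / δ := by ring
    have h3 : 6 * (m : ℝ) / δ ≤ k := by linarith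
    rw [div_le_iff₀ hδ0] at h3
    linarith
  have hu' : δ / (6 * m) ≤ 768 := by
    rw [div_le_iff₀ (by positivity)]
    linarith
  have hfin := one_sub_le_measureReal_satisfiesRIP (s := 3 * m) (δ := δ) hkn hk0 hsub hlaw hind
    (u := δ / (6 * m)) (by positivity) hu' hku (by push_cast; field_simp; norm_num)
  have hx : 6 * Real.log n ≤ c₂ * k / (m : ℝ) ^ 2 := by
    rw [le_div_iff₀ (by positivity)]
    have h1 : (12 : ℝ) / c₂ * (m : ℝ) ^ 2 * (Real.log n / 2)
        ≤ 12 / c₂ * (m : ℝ) ^ 3 * (Real.log n / 2) := by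
      gcongr
      norm_num
    have h2 : c₂ * (12 / c₂ * (m : ℝ) ^ 2 * (Real.log n / 2)) ≤ c₂ * k :=
      mul_le_mul_of_nonneg_left (by linarith) hc₂0.le
    have h3 : c₂ * (12 / c₂ * (m : ℝ) ^ 2 * (Real.log n / 2)) = 6 * Real.log n * m ^ 2 := by
      field_simp
      norm_num
    linarith
  have hexp : (k : ℝ) * (δ / (6 * m)) ^ 2 / 98304 = 2 * (c₂ * k / (m : ℝ) ^ 2) := by
    rw [hc₂]
    field_simp
    norm_num
  rw [hexp] at hfin
  linarith [sixteen_mul_sq_mul_exp_le hn2 hx]
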